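/- Let $k$ be an algebraically closed field (of any characteristic), $W$ a finite-dimensional vector space over $k$, and let $\mathbb P(W^\vee)$ be the space of lines in the dual space $W^\vee$, so that the vectors $w\in W$ are the linear coordinate functions on it ($w(x)=\varphi(w)$ for $x=k\varphi$, defined up to a common nonzero scalar). Let $X\subseteq\mathbb P(W^\vee)$ be a projective variety (a nonempty Zariski closed subset, irreducible or not) that is nondegenerate, i.e. not contained in any hyperplane. Let $g$ be an invertible semisimple linear operator on $W$, let $g^\vee\colon W^\vee\to W^\vee$, $\varphi\mapsto\varphi\circ g$, be its dual, and suppose that $X$ is invariant under the induced action of $g^\vee$ on $\mathbb P(W^\vee)$: $g^\vee X\subseteq X$. Then there exist an integer $n\neq 0$ and a point $x\in X$ such that (1) $(g^\vee)^n x=x$; and, moreover, (2) if $g$ is not torsion (i.e. $g^m\ne 1$ for all $m\geq 1$), then the same point $x$ has a nonzero coordinate $w(x)\neq 0$ for some eigenvector $w\in W$ of $g$ (a linear coordinate function which is an eigenfunction) whose eigenvalue is not a root of unity. -/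

import Mathlib

open scoped LinearAlgebra.Projectivization

namespace DualProj

/-- The common zero locus in `ℙ(W^∨)` (the space of lines in `W^∨`) of a set `S` of polynomials in
the linear coordinate functions `φ ↦ φ w`, `w ∈ W`: a variable of `MvPolynomial W k` is a vector
`w : W`, and its value at a functional `φ` is `φ w`. It is used for homogeneous polynomials only,
whose vanishing at a line does not depend on the chosen generator (`eval_rep_mk_eq_zero_iff`). -/
def zeroLocus {k W : Type*} [Field k] [AddCommGroup W] [Module k W]
    (S : Set (MvPolynomial W k)) : Set (ℙ k (Module.Dual k W)) :=
  {x | ∀ p ∈ S, MvPolynomial.eval (fun w : W => x.rep w) p = 0}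

/-- The vanishing of a homogeneous polynomial at a point of `ℙ(W^∨)` can be tested on any
generator of the line. -/
theorem eval_rep_mk_eq_zero_iff {k W : Type*} [Field k] [AddCommGroup W] [Module k W]
    {p : MvPolynomial W k} {d : ℕ} (hp : p.IsHomogeneous d)
    (φ : Module.Dual k W) (hφ : φ ≠ 0) :
    MvPolynomial.eval (fun w : W => (Projectivization.mk k φ hφ).rep w) p = 0 ↔
      MvPolynomial.eval (fun w : W => φ w) p = 0 := by
  obtain ⟨a, ha⟩ := Projectivization.exists_smul_eq_mk_rep k φ hφ
  have h : (fun w : W => (Projectivization.mk k φ hφ).rep w) = (a : k) • fun w : W => φ w := by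
    funext w
    rw [← ha]
    rfl
  have key : MvPolynomial.eval ((a : k) • fun w : W => φ w) p =
      (a : k) ^ d * MvPolynomial.eval (fun w : W => φ w) p := by
    rw [MvPolynomial.eval_eq, MvPolynomial.eval_eq, Finset.mul_sum]
    refine Finset.sum_congr rfl fun m hm => ?_
    have hd : m.degree = d := by
      by_contra hne
      exact MvPolynomial.mem_support_iff.1 hm (hp.coeff_eq_zero hne)
    simp only [Pi.smul_apply, smul_eq_mul, mul_pow, Finset.prod_mul_distrib,
      Finset.prod_pow_eq_pow_sum]
    rw [← hd, Finsupp.degree_apply]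
    ring
  rw [h, key]
  simp

/-- A projective variety in `ℙ(W^∨)`, over an algebraically closed field: a nonempty Zariski closed
subset (irreducibility is not required). -/
def IsProjectiveVariety {k W : Type*} [Field k] [AddCommGroup W] [Module k W]
    (X : Set (ℙ k (Module.Dual k W))) : Prop :=
  X.Nonempty ∧ ∃ S : Set (MvPolynomial W k), (∀ p ∈ S, ∃ d : ℕ, p.IsHomogeneous d) ∧
    X = zeroLocus S

/-- The hyperplane `{w = 0}` of `ℙ(W^∨)`; here `w` is meant to be nonzero. -/
def hyperplane {k W : Type*} [Field k] [AddCommGroup W] [Module k W] (w : W) :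
    Set (ℙ k (Module.Dual k W)) :=
  {x | x.rep w = 0}

/-- `X` is nondegenerate: it is not contained in any hyperplane. -/
def IsNondegenerate {k W : Type*} [Field k] [AddCommGroup W] [Module k W]
    (X : Set (ℙ k (Module.Dual k W))) : Prop :=
  ∀ w : W, w ≠ 0 → ¬ X ⊆ hyperplane w

end DualProj

/-! Choose a homomorphism `l` from `kˣ` to an ordered group whose kernel is the roots of unity, and
an eigenbasis of `g`. Along the orbit of `x`, the coordinates of maximal weight `M` should dominate,
and the truncation of `x` to them plays the role of a limit point of the orbit. It lies in `X`: the
value of a homogeneous equation at the truncation is the top-weight part of its value at `x`, and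
this part vanishes by interpolation along the orbit. Eigenvalues of equal weight differ by roots of
unity, so a power of `g.dualMap` fixes the truncation. If `M > 0`, the surviving eigenvalues are not
roots of unity. -/

/-- A linear relation among the powers of finitely many scalars can be cut down to any set of
scalars. -/
theorem sum_filter_eq_zero_of_forall_sum_mul_pow_eq_zero {σ k : Type*} [Field k] (s : Finset σ)
    (c μ : σ → k) (h : ∀ n : ℕ, ∑ m ∈ s, c m * μ m ^ n = 0) (P : k → Prop) [DecidablePred P] :
    ∑ m ∈ s with P (μ m), c m = 0 := by
  classical
  have hpoly : ∀ f : Polynomial k, ∑ m ∈ s, c m * f.eval (μ m) = 0 := by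
    intro f
    simp_rw [Polynomial.eval_eq_sum_range, Finset.mul_sum]
    rw [Finset.sum_comm]
    refine Finset.sum_eq_zero fun n _ => ?_
    rw [← mul_zero (f.coeff n), ← h n, Finset.mul_sum]
    exact Finset.sum_congr rfl fun m _ => by ring
  -- Take for `f` a polynomial equal to the indicator of `P` on the finitely many values of `μ`.
  rw [← hpoly (Lagrange.interpolate (s.image μ) id fun t => if P t then 1 else 0),
    Finset.sum_filter]
  refine Finset.sum_congr rfl fun m hm => ?_
  have := Lagrange.eval_interpolate_at_node (v := id) (fun t => if P t then (1 : k) else 0)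
    (Set.injOn_id _) (Finset.mem_image_of_mem μ hm)
  rw [id] at this
  rw [this]
  simp

/-- Every abelian group has a homomorphism to a linearly ordered group whose kernel is the torsion
subgroup. -/
theorem exists_addMonoidHom_linearOrder_eq_zero_iff.{u} (A : Type u) [AddCommGroup A] :
    ∃ (L : Type u) (_ : AddCommGroup L) (_ : LinearOrder L) (_ : IsOrderedAddMonoid L)
      (f : A →+ L), ∀ a, f a = 0 ↔ IsOfFinAddOrder a := by
  classical
  -- The kernel of `A → ℚ ⊗ A` is the torsion; a rational vector space is ordered lexicographically
  -- in the coordinates of a basis.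
  let V := TensorProduct ℤ ℚ A
  let B := Module.Basis.ofVectorSpace ℚ V
  let _ : LinearOrder (Module.Basis.ofVectorSpaceIndex ℚ V) := linearOrderOfSTO WellOrderingRel
  let f : A →+ Lex (Module.Basis.ofVectorSpaceIndex ℚ V →₀ ℚ) :=
    { toFun := fun a => toLex (B.repr (TensorProduct.mk ℤ ℚ A 1 a))
      map_zero' := by rw [map_zero, map_zero, toLex_zero]
      map_add' := fun a b => by rw [map_add, map_add, toLex_add] }
  refine ⟨_, inferInstance, inferInstance, inferInstance, f, fun a => ?_⟩
  have h0 : f a = 0 ↔ TensorProduct.mk ℤ ℚ A 1 a = 0 := by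
    change toLex (B.repr (TensorProduct.mk ℤ ℚ A 1 a)) = 0 ↔ _
    rw [toLex_eq_zero, map_eq_zero_iff _ B.repr.injective]
  rw [h0, IsLocalizedModule.eq_zero_iff (nonZeroDivisors ℤ), isOfFinAddOrder_iff_zsmul_eq_zero]
  constructor
  · rintro ⟨c, hc⟩
    exact ⟨c, nonZeroDivisors.ne_zero c.2, hc⟩
  · rintro ⟨n, hn, hc⟩
    exact ⟨⟨n, mem_nonZeroDivisors_of_ne_zero hn⟩, hc⟩

/-- If a homogeneous polynomial vanishes on the forward orbit of `x` under a diagonal matrix, then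
it vanishes at the truncation of `x` to the coordinates of highest weight. -/
theorem MvPolynomial.IsHomogeneous.eval_highest_weight_part_eq_zero {ι k L : Type*} [Fintype ι]
    [Field k] [AddCommGroup L] [LinearOrder L] [IsOrderedAddMonoid L] (l : Additive kˣ →+ L)
    (u : ι → kˣ) (M : L) (hM : ∀ i, l (.ofMul (u i)) ≤ M) (x : ι → k) {q : MvPolynomial ι k}
    {d : ℕ} (hq : q.IsHomogeneous d)
    (h : ∀ n : ℕ, MvPolynomial.eval (fun i => (u i : k) ^ n * x i) q = 0) :
    MvPolynomial.eval (fun i => if l (.ofMul (u i)) = M then x i else 0) q = 0 := by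
  classical
  have hsum : ∀ n : ℕ, ∑ m ∈ q.support, (q.coeff m * ∏ i, x i ^ m i) *
      ((∏ i, u i ^ m i : kˣ) : k) ^ n = 0 := by
    intro n
    rw [← h n, MvPolynomial.eval_eq']
    refine Finset.sum_congr rfl fun m _ => ?_
    simp only [mul_pow, Finset.prod_mul_distrib, Units.coe_prod, Units.val_pow_eq_pow_val,
      ← Finset.prod_pow, ← pow_mul, mul_comm n]
    ring
  -- Keep the monomials of weight `d • M`, the largest possible in degree `d`.
  refine Eq.trans ?_ (sum_filter_eq_zero_of_forall_sum_mul_pow_eq_zero _ _ _ hsum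
    fun t => ∃ v : kˣ, (v : k) = t ∧ l (.ofMul v) = d • M)
  rw [MvPolynomial.eval_eq', Finset.sum_filter]
  refine Finset.sum_congr rfl fun m hm => ?_
  have hd : ∑ i, m i = d := by
    rw [← Finsupp.degree_eq_sum]
    by_contra hne
    exact MvPolynomial.mem_support_iff.1 hm (hq.coeff_eq_zero hne)
  have hl : l (.ofMul (∏ i, u i ^ m i)) = ∑ i, m i • l (.ofMul (u i)) := by
    rw [ofMul_prod, map_sum]
    simp only [ofMul_pow, map_nsmul]
  have hP : (∃ v : kˣ, (v : k) = ((∏ i, u i ^ m i : kˣ) : k) ∧ l (.ofMul v) = d • M) ↔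
      ∑ i, m i • l (.ofMul (u i)) = ∑ i, m i • M := by
    rw [← Finset.sum_smul, hd, ← hl]
    constructor
    · rintro ⟨v, hv, hv'⟩
      rwa [← Units.ext hv]
    · exact fun hv => ⟨_, rfl, hv⟩
  -- As no weight exceeds `M`, equality of the sums is termwise: only top-weight variables occur in
  -- such a monomial.
  rw [if_congr (hP.trans (Finset.sum_eq_sum_iff_of_le fun i _ =>
    nsmul_le_nsmul_right (hM i) _)) rfl rfl]
  split_ifs with hc
  · congr 1
    refine Finset.prod_congr rfl fun i _ => ?_
    split_ifs with hi
    · rfl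
    · have : m i = 0 := by
        by_contra hmi
        exact (nsmul_lt_nsmul_right hmi (lt_of_le_of_ne (hM i) hi)).ne (hc i (Finset.mem_univ i))
      simp [this]
  · push Not at hc
    obtain ⟨i, -, hi⟩ := hc
    rw [Finset.prod_eq_zero (Finset.mem_univ i), mul_zero]
    rw [if_neg fun e => hi (by rw [e]), zero_pow fun e => hi (by rw [e, zero_smul, zero_smul])]

/-- A semisimple operator over an algebraically closed field has a finite basis of eigenvectors. -/
theorem Module.End.IsSemisimple.exists_basis_hasEigenvector {k W : Type*} [Field k]
    [IsAlgClosed k] [AddCommGroup W] [Module k W] [FiniteDimensional k W] {f : Module.End k W}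
    (hf : f.IsSemisimple) :
    ∃ (s : Set W) (_ : Fintype s) (b : Module.Basis s k W) (e : s → k),
      ∀ i, f.HasEigenvector (e i) (b i) := by
  have hs : ⊤ ≤ Submodule.span k {w : W | ∃ e, w ∈ f.eigenspace e} := by
    rw [← hf.iSup_eigenspace_eq_top]
    exact iSup_le fun e w hw => Submodule.subset_span ⟨e, hw⟩
  let b := Module.Basis.ofSpan hs
  have hb : ∀ i, ∃ e, b i ∈ f.eigenspace e := fun i =>
    Module.Basis.ofSpan_subset hs ⟨i, rfl⟩
  choose e he using hb
  exact ⟨_, FiniteDimensional.fintypeBasisIndex b, b, e, fun i => ⟨he i, b.ne_zero i⟩⟩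

theorem LinearEquiv.dualMap_pow_apply {k W : Type*} [Field k] [AddCommGroup W] [Module k W]
    (g : W ≃ₗ[k] W) (n : ℕ) (φ : Module.Dual k W) (w : W) :
    (g.dualMap ^ n) φ w = φ ((g ^ n) w) := by
  induction n generalizing φ w with
  | zero => simp
  | succ n ih =>
    rw [pow_succ, LinearEquiv.mul_apply, ih, LinearEquiv.dualMap_apply, pow_succ',
      LinearEquiv.mul_apply]

/-- If a closed set is invariant under a diagonalizable operator, then the truncation of a
functional to its coordinates of highest weight stays in the closed set. -/
theorem DualProj.mk_highest_weight_part_mem_zeroLocus {ι k W L : Type*} [Fintype ι] [Field k]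
    [AddCommGroup W] [Module k W] [AddCommGroup L] [LinearOrder L] [IsOrderedAddMonoid L]
    (l : Additive kˣ →+ L) {S : Set (MvPolynomial W k)}
    (hS : ∀ p ∈ S, ∃ d : ℕ, p.IsHomogeneous d) (g : W ≃ₗ[k] W)
    (hinv : ∀ x ∈ DualProj.zeroLocus S, g.dualMap • x ∈ DualProj.zeroLocus S)
    (b : Module.Basis ι k W) (u : ι → kˣ) (hb : ∀ i, g (b i) = (u i : k) • b i) (M : L)
    (hM : ∀ i, l (.ofMul (u i)) ≤ M) (φ ψ : Module.Dual k W) (hφ : φ ≠ 0) (hψ : ψ ≠ 0)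
    (hφS : Projectivization.mk k φ hφ ∈ DualProj.zeroLocus S)
    (h1 : ∀ i, l (.ofMul (u i)) = M → ψ (b i) = φ (b i))
    (h0 : ∀ i, l (.ofMul (u i)) ≠ M → ψ (b i) = 0) :
    Projectivization.mk k ψ hψ ∈ DualProj.zeroLocus S := by
  classical
  intro p hp
  obtain ⟨d, hd⟩ := hS p hp
  rw [DualProj.eval_rep_mk_eq_zero_iff hd]
  let F : W → MvPolynomial ι k := fun w => ∑ i, .C (b.repr w i) * .X i
  have hF : ∀ w, (F w).IsHomogeneous 1 := fun w =>
    MvPolynomial.IsHomogeneous.sum _ _ _ fun i _ => MvPolynomial.isHomogeneous_C_mul_X _ _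
  have hev : ∀ χ : Module.Dual k W, MvPolynomial.eval (fun w => χ w) p =
      MvPolynomial.eval (fun i => χ (b i)) (MvPolynomial.aeval F p) := by
    intro χ
    rw [MvPolynomial.aeval_def, MvPolynomial.algebraMap_eq, MvPolynomial.eval_eval₂,
      ← MvPolynomial.eval₂_id]
    congr 1
    · ext; simp
    · funext w
      conv_lhs => rw [← b.sum_repr w, map_sum]
      simp [F]
  have hq : (MvPolynomial.aeval F p).IsHomogeneous d := by
    simpa using hd.aeval F hF
  have hpow : ∀ (n : ℕ) (i : ι), (g ^ n) (b i) = (u i : k) ^ n • b i := by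
    intro n i
    induction n with
    | zero => simp
    | succ n ih => rw [pow_succ', LinearEquiv.mul_apply, ih, map_smul, hb, smul_smul, pow_succ]
  have horb : ∀ n : ℕ, (g.dualMap ^ n) • Projectivization.mk k φ hφ ∈ DualProj.zeroLocus S := by
    intro n
    induction n with
    | zero => simpa using hφS
    | succ n ih => rw [pow_succ', mul_smul]; exact hinv _ ih
  rw [hev]
  have key := hq.eval_highest_weight_part_eq_zero l u M hM (fun i => φ (b i)) fun n => by
    have := horb n p hp
    rw [Projectivization.smul_mk, DualProj.eval_rep_mk_eq_zero_iff hd, hev] at this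
    convert this using 3
    funext i
    rw [LinearEquiv.smul_def, LinearEquiv.dualMap_pow_apply, hpow, map_smul, smul_eq_mul]
  convert key using 3
  funext i
  split_ifs with hi
  · exact h1 i hi
  · exact h0 i hi

theorem mainTheorem12 {k W : Type*} [Field k] [IsAlgClosed k] [AddCommGroup W] [Module k W]
    [FiniteDimensional k W] (X : Set (ℙ k (Module.Dual k W)))
    (hX : DualProj.IsProjectiveVariety X) (hnd : DualProj.IsNondegenerate X)
    (g : W ≃ₗ[k] W) (hg : Module.End.IsSemisimple (g : W →ₗ[k] W))
    (hinv : ∀ x ∈ X, g.dualMap • x ∈ X) :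
    ∃ n : ℤ, n ≠ 0 ∧ ∃ x ∈ X, (g.dualMap ^ n) • x = x ∧
      (¬ IsOfFinOrder g → ∃ (w : W) (e : k),
        Module.End.HasEigenvector (g : W →ₗ[k] W) e w ∧ ¬ IsOfFinOrder e ∧ x.rep w ≠ 0) := by
  classical
  obtain ⟨⟨x₀, hx₀⟩, S, hS, rfl⟩ := hX
  by_cases htor : IsOfFinOrder g
  · obtain ⟨n, hn, hgn⟩ := isOfFinOrder_iff_pow_eq_one.1 htor
    refine ⟨n, by exact_mod_cast hn.ne', x₀, hx₀, ?_, fun h => absurd htor h⟩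
    have : g.dualMap ^ n = 1 := by
      ext φ w
      rw [LinearEquiv.dualMap_pow_apply, hgn]
      rfl
    rw [zpow_natCast, this, one_smul]
  obtain ⟨s, _, b, e, hbe⟩ := hg.exists_basis_hasEigenvector
  have hb' : ∀ i, g (b i) = e i • b i := fun i => (hbe i).apply_eq_smul
  have he : ∀ i, e i ≠ 0 := fun i h0 => b.ne_zero i (by
    have := hb' i
    rwa [h0, zero_smul, LinearEquiv.map_eq_zero_iff] at this)
  let u : s → kˣ := fun i => Units.mk0 (e i) (he i)
  have hb : ∀ i, g (b i) = (u i : k) • b i := hb'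
  have hpow : ∀ (n : ℕ) (i : s), (g ^ n) (b i) = ((u i ^ n : kˣ) : k) • b i := by
    intro n i
    induction n with
    | zero => simp
    | succ n ih =>
      rw [pow_succ', LinearEquiv.mul_apply, ih, map_smul, hb, smul_smul, pow_succ, Units.val_mul]
  obtain ⟨i₀, hi₀⟩ : ∃ i, ¬ IsOfFinOrder (u i) := by
    by_contra! hall
    refine htor (isOfFinOrder_iff_pow_eq_one.2 ⟨∏ i, orderOf (u i),
      Finset.prod_pos fun i _ => (hall i).orderOf_pos, ?_⟩)
    apply LinearEquiv.toLinearMap_injective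
    refine b.ext fun i => ?_
    rw [LinearEquiv.coe_coe, hpow, orderOf_dvd_iff_pow_eq_one.1
      (Finset.dvd_prod_of_mem (fun i => orderOf (u i)) (Finset.mem_univ i))]
    simp
  obtain ⟨L, _, _, _, l, hl, hli₀⟩ : ∃ (L : Type _) (_ : AddCommGroup L) (_ : LinearOrder L)
      (_ : IsOrderedAddMonoid L) (l : Additive kˣ →+ L),
      (∀ a, l a = 0 ↔ IsOfFinAddOrder a) ∧ 0 < l (.ofMul (u i₀)) := by
    obtain ⟨L, i1, i2, i3, l, hl⟩ := exists_addMonoidHom_linearOrder_eq_zero_iff (Additive kˣ)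
    have hne : l (.ofMul (u i₀)) ≠ 0 := by
      rwa [Ne, hl, isOfFinAddOrder_ofMul_iff]
    -- Replacing `l` by `-l` if necessary makes the maximal weight positive.
    rcases hne.lt_or_gt with h | h
    · exact ⟨L, i1, i2, i3, -l, fun a => by rw [AddMonoidHom.neg_apply, neg_eq_zero, hl],
        by simpa using h⟩
    · exact ⟨L, i1, i2, i3, l, hl, h⟩
  obtain ⟨i₁, -, hmax⟩ := Finset.exists_max_image Finset.univ (fun i => l (.ofMul (u i)))
    ⟨i₀, Finset.mem_univ _⟩
  set M := l (.ofMul (u i₁)) with hMdef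
  have hMpos : 0 < M := hli₀.trans_le (hmax i₀ (Finset.mem_univ _))
  -- Nondegeneracy gives a point whose truncation is nonzero.
  obtain ⟨x, hxX, hx⟩ := Set.not_subset.1 (hnd (b i₁) (b.ne_zero i₁))
  have hx₁ : x.rep (b i₁) ≠ 0 := hx
  let ψ : Module.Dual k W := b.constr k fun i => if l (.ofMul (u i)) = M then x.rep (b i) else 0
  have hψb : ∀ i, ψ (b i) = if l (.ofMul (u i)) = M then x.rep (b i) else 0 :=
    b.constr_basis k _
  have hψ₁ : ψ (b i₁) ≠ 0 := by rwa [hψb, if_pos rfl]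
  have hψ : ψ ≠ 0 := fun h => hψ₁ (by rw [h, LinearMap.zero_apply])
  have hmem : Projectivization.mk k ψ hψ ∈ DualProj.zeroLocus S :=
    DualProj.mk_highest_weight_part_mem_zeroLocus l hS g hinv b u hb M
      (fun i => hmax i (Finset.mem_univ i)) x.rep ψ x.rep_nonzero hψ (by rwa [x.mk_rep])
      (fun i hi => by rw [hψb, if_pos hi]) (fun i hi => by rw [hψb, if_neg hi])
  have hfin : ∀ i, l (.ofMul (u i)) = M → IsOfFinOrder (u i / u i₁) := fun i hi => by
    rw [← isOfFinAddOrder_ofMul_iff, ← hl, ofMul_div, map_sub, hi, sub_self]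
  -- `N` kills all ratios of top eigenvalues, so `g ^ N` is scalar on the span of their
  -- eigenvectors.
  let N : ℕ := ∏ i with l (.ofMul (u i)) = M, orderOf (u i / u i₁)
  have hN : N ≠ 0 := Finset.prod_ne_zero_iff.2 fun i hi =>
    (hfin i (Finset.mem_filter.1 hi).2).orderOf_pos.ne'
  have hNpow : ∀ i, l (.ofMul (u i)) = M → u i ^ N = u i₁ ^ N := fun i hi => by
    rw [← div_eq_one, ← div_pow]
    exact orderOf_dvd_iff_pow_eq_one.1 (Finset.dvd_prod_of_mem (fun i => orderOf (u i / u i₁))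
      (Finset.mem_filter.2 ⟨Finset.mem_univ i, hi⟩))
  refine ⟨N, by exact_mod_cast hN, _, hmem, ?_, fun _ => ⟨b i₁, e i₁, hbe i₁, ?_, ?_⟩⟩
  · rw [zpow_natCast, Projectivization.smul_mk, Projectivization.mk_eq_mk_iff]
    refine ⟨u i₁ ^ N, b.ext fun i => ?_⟩
    rw [LinearEquiv.smul_def, LinearEquiv.dualMap_pow_apply, hpow, map_smul, Units.smul_def,
      LinearMap.smul_apply]
    by_cases hi : l (.ofMul (u i)) = M
    · rw [hNpow i hi]
    · rw [hψb, if_neg hi, smul_zero, smul_zero]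
  · have : ¬ IsOfFinOrder (u i₁) := by
      rw [← isOfFinAddOrder_ofMul_iff, ← hl]
      exact hMpos.ne'
    rwa [← Units.isOfFinOrder_val] at this
  · obtain ⟨a, ha⟩ := Projectivization.exists_smul_eq_mk_rep k ψ hψ
    rw [← ha, Units.smul_def, LinearMap.smul_apply, smul_eq_mul]
    exact mul_ne_zero a.ne_zero hψ₁
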